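/- A co-tree is a poset with a greatest element in which every principal upset $\{y : y\ge x\}$ is a chain. For a positive integer $n$, let $\mathcal C_n$ be the $n$-comb: the poset on $2n$ distinct points $c_1,\dots,c_n,c_1',\dots,c_n'$ in which $c_1<\dots<c_n$, each $c_i'$ is minimal, and $c_i'<c_j$ if and only if $i\le j$ (so that $c_i\not\le c_j'$ for all $i,j$). Let $\mathcal T_n$ be the set of all finite co-trees, with order isomorphic co-trees identified, into which $\mathcal C_n$ does not order-embed (an order embedding is a map $h$ with $p\le q\iff h(p)\le h(q)$). A map $f\colon Y\to X$ of posets is a bi-p-morphism if it is order preserving and, for all $y\in Y$ and $x\in X$: if $f(y)\le x$ then $f(z)=x$ for some $z\ge y$; and if $x\le f(y)$ then $f(z)=x$ for some $z\le y$. Write $X\le_p Y$ if there is a surjective bi-p-morphism from $Y$ onto $X$; this is a partial order on $\mathcal T_n$. For $B,C\subseteq\omega$ write $B\sqsubseteq C$ if the increasing enumeration of $C$ extends that of $B$. A front on an infinite set $A\subseteq\omega$ is a family $F$ of finite subsets of $\omega$ such that (i) $F=\{\emptyset\}$ or $\bigcup F=A$; (ii) if $s,t\in F$ and $s\sqsubseteq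 t$ then $s=t$; (iii) for every infinite $B\subseteq A$ there is exactly one $s\in F$ with $s\sqsubseteq B$. For finite $s,t\subseteq\omega$ write $s\lhd t$ if there is an infinite $B\subseteq\omega$ with $s\sqsubseteq B$ and $t\sqsubseteq B\setminus\{\min B\}$. A poset $P$ is a better partial order (BPO) if for every front $F$ (on some infinite $A\subseteq\omega$) and every map $f\colon F\to P$ there are $s,t\in F$ with $s\lhd t$ and $f(s)\le f(t)$. Proposition. For every positive integer $n$, the poset $(\mathcal T_n,\le_p)$ is a BPO. In particular, $(\mathcal T_n,\le_p)$ has no infinite antichains. -/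

import Mathlib

universe u v

namespace CoTrees

/-! ### Better partial orders -/

/-- `C` extends `B`: the increasing enumeration of `B` is an initial part of that of `C`. -/
def Extends (B C : Set ℕ) : Prop :=
  B ⊆ C ∧ ∀ b ∈ B, ∀ c ∈ C, c ≤ b → c ∈ B

/-- `F` is a front on the set `A` of natural numbers. -/
structure IsFrontOn (F : Set (Finset ℕ)) (A : Set ℕ) : Prop where
  base : F = {∅} ∨ (⋃ s ∈ F, (s : Set ℕ)) = A
  eq_of_extends : ∀ s ∈ F, ∀ t ∈ F, Extends (s : Set ℕ) (t : Set ℕ) → s = t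
  existsUnique : ∀ B : Set ℕ, B ⊆ A → B.Infinite → ∃! s : Finset ℕ, s ∈ F ∧ Extends (s : Set ℕ) B

/-- `F` is a front, that is, a front on some infinite set of natural numbers. -/
def IsFront (F : Set (Finset ℕ)) : Prop :=
  ∃ A : Set ℕ, A.Infinite ∧ IsFrontOn F A

/-- `t` is a shift of `s`. Here `sInf B` is the minimum of the infinite (so nonempty) set `B`. -/
def IsShift (s t : Finset ℕ) : Prop :=
  ∃ B : Set ℕ, B.Infinite ∧ Extends (s : Set ℕ) B ∧ Extends (t : Set ℕ) (B \ {sInf B})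

/-- The super-sequence `f : F → P` is bad for the order of `P`. -/
def IsBad {P : Type v} [PartialOrder P] {F : Set (Finset ℕ)} (f : F → P) : Prop :=
  ∀ s t : F, IsShift (s : Finset ℕ) (t : Finset ℕ) → ¬ f s ≤ f t

/-- `P` is a better partial order: there are no bad super-sequences in `P`. -/
def IsBPO (P : Type v) [PartialOrder P] : Prop :=
  ∀ F : Set (Finset ℕ), IsFront F → ∀ f : F → P, ¬ IsBad f

/-! ### Bi-p-morphisms -/

/-- `f` is a bi-p-morphism of posets. -/
structure IsBiPMorphism {X Y : Type*} [PartialOrder X] [PartialOrder Y] (f : X → Y) : Prop where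
  mono : ∀ x z : X, x ≤ z → f x ≤ f z
  up : ∀ (x : X) (y : Y), f x ≤ y → ∃ z : X, x ≤ z ∧ f z = y
  down : ∀ (x : X) (y : Y), y ≤ f x → ∃ z : X, z ≤ x ∧ f z = y

theorem IsBiPMorphism.comp {X Y Z : Type*} [PartialOrder X] [PartialOrder Y] [PartialOrder Z]
    {g : Y → Z} {f : X → Y} (hg : IsBiPMorphism g) (hf : IsBiPMorphism f) :
    IsBiPMorphism (g ∘ f) where
  mono _ _ h := hg.mono _ _ (hf.mono _ _ h)
  up _ y h := by
    obtain ⟨w, hw, rfl⟩ := hg.up _ y h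
    obtain ⟨z, hz, rfl⟩ := hf.up _ w hw
    exact ⟨z, hz, rfl⟩
  down _ y h := by
    obtain ⟨w, hw, rfl⟩ := hg.down _ y h
    obtain ⟨z, hz, rfl⟩ := hf.down _ w hw
    exact ⟨z, hz, rfl⟩

theorem isBiPMorphism_orderIso {X Y : Type*} [PartialOrder X] [PartialOrder Y] (e : X ≃o Y) :
    IsBiPMorphism e where
  mono _ _ h := e.monotone h
  up _ y h := ⟨e.symm y, e.le_symm_apply.2 h, e.apply_symm_apply y⟩
  down _ y h := ⟨e.symm y, e.symm_apply_le.2 h, e.apply_symm_apply y⟩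

/-! ### Finite co-trees, up to isomorphism -/

/-- A co-tree is a poset with a greatest element whose principal upsets are chains. -/
structure IsCoTree (X : Type u) [PartialOrder X] : Prop where
  exists_coroot : ∃ r : X, ∀ x : X, x ≤ r
  isChain_Ici : ∀ x : X, IsChain (· ≤ ·) (Set.Ici x)

/-- Finite co-trees (not yet up to isomorphism). -/
structure FinCoTree where
  carrier : Type u
  [order : PartialOrder carrier]
  [finite : Finite carrier]
  isCoTree : IsCoTree carrier

attribute [instance] FinCoTree.order FinCoTree.finite

/-- Order isomorphism of finite co-trees. -/
instance FinCoTree.setoid : Setoid FinCoTree.{u} where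
  r X Y := Nonempty (X.carrier ≃o Y.carrier)
  iseqv :=
    { refl := fun X => ⟨OrderIso.refl X.carrier⟩
      symm := fun ⟨e⟩ => ⟨e.symm⟩
      trans := fun ⟨e⟩ ⟨e'⟩ => ⟨e.trans e'⟩ }

/-- `X` is a bi-p-morphic image of `Y`. -/
def FinCoTree.LeP (X Y : FinCoTree.{u}) : Prop :=
  ∃ f : Y.carrier → X.carrier, IsBiPMorphism f ∧ Function.Surjective f

theorem FinCoTree.LeP.trans {X Y Z : FinCoTree.{u}} (h : X.LeP Y) (h' : Y.LeP Z) : X.LeP Z := by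
  obtain ⟨f, hf, hfs⟩ := h
  obtain ⟨g, hg, hgs⟩ := h'
  exact ⟨f ∘ g, hf.comp hg, hfs.comp hgs⟩

theorem FinCoTree.leP_of_equiv {X Y : FinCoTree.{u}} (h : X ≈ Y) : X.LeP Y := by
  obtain ⟨e⟩ := h
  exact ⟨e.symm, isBiPMorphism_orderIso e.symm, e.symm.surjective⟩

theorem FinCoTree.LeP.antisymm {X Y : FinCoTree.{u}} (h : X.LeP Y) (h' : Y.LeP X) : X ≈ Y := by
  obtain ⟨f, hf, hfs⟩ := h
  obtain ⟨g, -, hgs⟩ := h'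
  have hinj : Function.Injective f := by
    have hgf : Function.Injective (g ∘ f) := Finite.injective_iff_surjective.2 (hgs.comp hfs)
    exact hgf.of_comp
  have e : Y.carrier ≃o X.carrier :=
    { toEquiv := Equiv.ofBijective f ⟨hinj, hfs⟩
      map_rel_iff' := by
        intro a b
        refine ⟨fun hab => ?_, fun hab => hf.mono _ _ hab⟩
        obtain ⟨z, hz, hzb⟩ := hf.up a (f b) hab
        exact hinj hzb ▸ hz }
  exact ⟨e.symm⟩

/-- The set of finite co-trees, where order isomorphic co-trees are identified. -/
def CoTreeClass : Type (u + 1) := Quotient FinCoTree.setoid.{u}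

/-- The bi-p-morphic image order `≤_p` on finite co-trees. -/
instance CoTreeClass.partialOrder : PartialOrder CoTreeClass.{u} where
  le := Quotient.lift₂ FinCoTree.LeP (by
    intro X Y X' Y' hX hY
    exact propext
      ⟨fun h => ((FinCoTree.leP_of_equiv (Setoid.symm hX)).trans h).trans
          (FinCoTree.leP_of_equiv hY),
        fun h => ((FinCoTree.leP_of_equiv hX).trans h).trans
          (FinCoTree.leP_of_equiv (Setoid.symm hY))⟩)
  le_refl := by
    rintro ⟨X⟩
    exact FinCoTree.leP_of_equiv (Setoid.refl X)
  le_trans := by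
    rintro ⟨X⟩ ⟨Y⟩ ⟨Z⟩ h h'
    exact FinCoTree.LeP.trans (X := X) (Y := Y) (Z := Z) h h'
  le_antisymm := by
    rintro ⟨X⟩ ⟨Y⟩ h h'
    exact Quotient.sound (FinCoTree.LeP.antisymm (X := X) (Y := Y) h h')

/-! ### Combs -/

/-- The points of the `n`-comb: `spine i` is `c_{i+1}` and `tooth i` is `c'_{i+1}`. -/
inductive Comb (n : ℕ) : Type where
  | spine (i : Fin n) : Comb n
  | tooth (i : Fin n) : Comb n

/-- The order of the comb: the spine is the chain `c_1 < ⋯ < c_n`, and the teeth are minimal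
points, with `c'_i` below `c_j` exactly when `i ≤ j`. -/
def Comb.Le {n : ℕ} : Comb n → Comb n → Prop
  | .spine i, .spine j => i ≤ j
  | .tooth i, .spine j => i ≤ j
  | .spine _, .tooth _ => False
  | .tooth i, .tooth j => i = j

instance Comb.partialOrder (n : ℕ) : PartialOrder (Comb n) where
  le := Comb.Le
  le_refl := by rintro (i | i) <;> simp [Comb.Le]
  le_trans := by
    rintro (i | i) (j | j) (k | k) <;> simp only [Comb.Le] <;> grind
  le_antisymm := by
    rintro (i | i) (j | j) <;> simp only [Comb.Le] <;> grind

/-- `T n` is the set of (isomorphism classes of) finite co-trees into which the `n`-comb does not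
order-embed. -/
def T (n : ℕ) : Set CoTreeClass.{u} :=
  {q | ∃ X : FinCoTree.{u}, (Quotient.mk _ X : CoTreeClass.{u}) = q ∧
    IsEmpty (Comb n ↪o X.carrier)}

end CoTrees

-- Induction on `n`. `T 0` is empty because the empty comb embeds everywhere. A finite co-tree
-- omitting the `(n+1)`-comb has a point `x` comparable to everything such that every `↓z` with `z <
-- x` omits the `n`-comb (`FinCoTree.exists_stem`): it is a chain on top of a finite family of
-- branches from `T n`. A longer chain, together with a surjection between the families that is
-- decreasing for `≤_p`, glues to a surjective bi-p-morphism (`FinCoTree.leP_of_branches`). So it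
-- suffices that finite families over a better quasi-order are again better quasi-ordered by such
-- surjections (`Bqo.family_surjLE`). By Hall's theorem this splits into two conditions whose
-- failures have witnesses in better quasi-orders (`Bqo.of_witness`).
--
-- Fronts are replaced by locally constant arrays, where intersecting two relations is an
-- application of Ramsey's theorem for locally constant colourings.

universe w

namespace CoTrees

open Filter Topology

/-! ### Locally constant arrays and better quasi-orders -/

/-- Every locally constant array of elements of `Q`, indexed by the increasing sequences of
natural numbers, has an entry related to the entry at the shifted sequence. -/
def Bqo {Q : Type v} (R : Q → Q → Prop) : Prop :=
  ∀ g : (ℕ → ℕ) → Q, IsLocallyConstant g →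
    ∃ X : ℕ → ℕ, StrictMono X ∧ R (g X) (g (X ∘ Nat.succ))

theorem IsLocallyConstant.comp_left {Q : Type v} {g : (ℕ → ℕ) → Q} (hg : IsLocallyConstant g)
    (A : ℕ → ℕ) : IsLocallyConstant fun X => g (A ∘ X) :=
  hg.comp_continuous (f := fun X : ℕ → ℕ => A ∘ X)
    (continuous_pi fun i => continuous_of_discreteTopology.comp (continuous_apply i))

theorem IsLocallyConstant.comp_shift {Q : Type v} {g : (ℕ → ℕ) → Q} (hg : IsLocallyConstant g) :
    IsLocallyConstant fun X => g (X ∘ Nat.succ) :=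
  hg.comp_continuous (f := fun X : ℕ → ℕ => X ∘ Nat.succ)
    (continuous_pi fun i => continuous_apply (i + 1))

theorem IsLocallyConstant.exists_agree {Q : Type v} {g : (ℕ → ℕ) → Q} (hg : IsLocallyConstant g)
    (X : ℕ → ℕ) : ∃ N, ∀ Y : ℕ → ℕ, (∀ i < N, Y i = X i) → g Y = g X := by
  have hopen : IsOpen (g ⁻¹' {g X}) := hg {g X}
  obtain ⟨N, hN⟩ := (PiNat.isTopologicalBasis_cylinders (fun _ : ℕ => ℕ)).exists_subset_of_mem_open
    (show X ∈ g ⁻¹' {g X} from rfl) hopen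
  obtain ⟨⟨Z, m, rfl⟩, hX, hsub⟩ := hN
  refine ⟨m, fun Y hY => hsub fun i hi => ?_⟩
  rw [hY i hi, hX i hi]

theorem isLocallyConstant_of_agree {Q : Type v} {g : (ℕ → ℕ) → Q}
    (h : ∀ X, ∃ N, ∀ Y : ℕ → ℕ, (∀ i < N, Y i = X i) → g Y = g X) : IsLocallyConstant g := by
  rw [IsLocallyConstant.iff_eventually_eq]
  intro X
  obtain ⟨N, hN⟩ := h X
  have : PiNat.cylinder X N ∈ 𝓝 X :=
    (PiNat.isOpen_cylinder (fun _ : ℕ => ℕ) X N).mem_nhds (PiNat.self_mem_cylinder X N)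
  filter_upwards [this] with Y hY using hN Y fun i hi => hY i hi

/-! ### Ramsey theorem for locally constant colourings -/

/-- The sequence `n, X 0, X 1, …`. -/
def cons (n : ℕ) (X : ℕ → ℕ) : ℕ → ℕ
  | 0 => n
  | i + 1 => X i

theorem cons_zero_shift (X : ℕ → ℕ) : cons (X 0) (X ∘ Nat.succ) = X := by
  funext i
  cases i <;> rfl

theorem exists_strictMono_factor {A D : ℕ → ℕ} (hA : StrictMono A) (hD : StrictMono D)
    (h : ∀ i, D i ∈ Set.range A) : ∃ E, StrictMono E ∧ D = A ∘ E := by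
  choose E hE using h
  refine ⟨E, fun i j hij => ?_, funext fun i => (hE i).symm⟩
  rw [← hA.lt_iff_lt, hE, hE]
  exact hD hij

/-- Below every increasing sequence there is one whose subsequences all have the same colour. -/
def HasHomogeneous (c : (ℕ → ℕ) → Prop) : Prop :=
  ∀ A : ℕ → ℕ, StrictMono A → ∃ B : ℕ → ℕ, StrictMono B ∧
    ∃ p : Prop, ∀ X : ℕ → ℕ, StrictMono X → (c (A ∘ B ∘ X) ↔ p)

theorem HasHomogeneous.of_cons {c : (ℕ → ℕ) → Prop}
    (h : ∀ n, HasHomogeneous fun X => c (cons n X)) : HasHomogeneous c := by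
  intro A hA
  have step : ∀ A : {A : ℕ → ℕ // StrictMono A}, ∃ B : {B : ℕ → ℕ // StrictMono B},
      (∃ p : Prop, ∀ X : ℕ → ℕ, StrictMono X → (c (cons (A.1 0) (B.1 ∘ X)) ↔ p)) ∧
        ∃ E : ℕ → ℕ, StrictMono E ∧ B.1 = A.1 ∘ Nat.succ ∘ E := by
    rintro ⟨A, hA⟩
    have hS : StrictMono (A ∘ Nat.succ) := hA.comp (fun _ _ => Nat.succ_lt_succ)
    obtain ⟨B, hB, p, hp⟩ := h (A 0) (A ∘ Nat.succ) hS
    exact ⟨⟨(A ∘ Nat.succ) ∘ B, hS.comp hB⟩, ⟨p, hp⟩, B, hB, rfl⟩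
  choose next hp hE using step
  choose p hp using hp
  choose E hEmono hE using hE
  -- Diagonalization: the terms of `D` after the `i`-th lie in `S (i + 1)`, so the colour of a
  -- subsequence of `D` depends only on its first term; the pigeonhole principle then fixes that
  -- colour.
  let S : ℕ → {A : ℕ → ℕ // StrictMono A} := fun i => next^[i] ⟨A, hA⟩
  have hS : ∀ i, S (i + 1) = next (S i) := fun i => Function.iterate_succ_apply' _ _ _
  have hrange : ∀ i j, Set.range (S (i + j)).1 ⊆ Set.range (S i).1 := by
    intro i j
    induction j with
    | zero => exact subset_rfl
    | succ j ih =>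
      refine subset_trans ?_ ih
      rw [← add_assoc, hS, hE]
      exact Set.range_comp_subset_range _ _
  let D : ℕ → ℕ := fun i => (S i).1 0
  have hD : StrictMono D := by
    refine strictMono_nat_of_lt_succ fun i => ?_
    change (S i).1 0 < (S (i + 1)).1 0
    rw [hS, hE]
    exact (S i).2 (Nat.succ_pos _)
  have hDmem : ∀ i j, i ≤ j → D j ∈ Set.range (S i).1 := by
    intro i j hij
    obtain ⟨k, rfl⟩ := Nat.exists_eq_add_of_le hij
    exact hrange i k ⟨0, rfl⟩
  obtain ⟨K, hK, q, hq⟩ : ∃ K : ℕ → ℕ, StrictMono K ∧ ∃ q : Prop, ∀ i, p (S (K i)) ↔ q := by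
    by_cases hfreq : ∃ᶠ i in atTop, p (S i)
    · obtain ⟨K, hK, h⟩ := extraction_of_frequently_atTop hfreq
      exact ⟨K, hK, True, fun i => iff_of_true (h i) trivial⟩
    · rw [not_frequently] at hfreq
      obtain ⟨K, hK, h⟩ := extraction_of_frequently_atTop hfreq.frequently
      exact ⟨K, hK, False, fun i => iff_of_false (h i) id⟩
  obtain ⟨G, hG, hDG⟩ := exists_strictMono_factor hA hD fun i => hDmem 0 i (Nat.zero_le i)
  refine ⟨G ∘ K, hG.comp hK, q, fun X hX => ?_⟩
  have hDK : A ∘ (G ∘ K) ∘ X = D ∘ K ∘ X := by rw [hDG]; rfl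
  have hDKX : StrictMono (D ∘ K ∘ X) := hD.comp (hK.comp hX)
  rw [hDK, ← cons_zero_shift (D ∘ K ∘ X)]
  obtain ⟨Z, hZ, hZeq⟩ := exists_strictMono_factor (S (K (X 0) + 1)).2
    (hDKX.comp (fun _ _ => Nat.succ_lt_succ) : StrictMono ((D ∘ K ∘ X) ∘ Nat.succ))
    fun i => hDmem _ _ (Nat.succ_le_of_lt (hK (hX (Nat.succ_pos i))))
  rw [hZeq, hS]
  exact (hp (S (K (X 0))) Z hZ).trans (hq _)

/-- Otherwise `HasHomogeneous.of_cons` yields heads `X 0, X 1, …` such that fixing any finite number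
of them leaves a colouring without homogeneous sequences; but `c` is constant near `X`. -/
theorem IsLocallyConstant.hasHomogeneous {c : (ℕ → ℕ) → Prop} (hc : IsLocallyConstant c) :
    HasHomogeneous c := by
  by_contra hcon
  have step : ∀ d : {d : (ℕ → ℕ) → Prop // ¬ HasHomogeneous d},
      ∃ n, ¬ HasHomogeneous fun X => d.1 (cons n X) := by
    rintro ⟨d, hd⟩
    by_contra! h
    exact hd (HasHomogeneous.of_cons h)
  choose n hn using step
  let next : {d : (ℕ → ℕ) → Prop // ¬ HasHomogeneous d} →
      {d : (ℕ → ℕ) → Prop // ¬ HasHomogeneous d} := fun d => ⟨_, hn d⟩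
  let S : ℕ → {d : (ℕ → ℕ) → Prop // ¬ HasHomogeneous d} := fun i => next^[i] ⟨c, hcon⟩
  have hS : ∀ i, S (i + 1) = next (S i) := fun i => Function.iterate_succ_apply' _ _ _
  let X : ℕ → ℕ := fun i => n (S i)
  have key : ∀ k Y, ∃ Z : ℕ → ℕ, (∀ i < k, Z i = X i) ∧ (∀ i, Z (i + k) = Y i) ∧
      ((S k).1 Y ↔ c Z) := by
    intro k
    induction k with
    | zero => exact fun Y => ⟨Y, by simp, fun _ => rfl, Iff.rfl⟩
    | succ k ih =>
      intro Y
      obtain ⟨Z, h1, h2, h3⟩ := ih (cons (X k) Y)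
      refine ⟨Z, fun i hi => ?_, fun i => ?_, ?_⟩
      · rcases Nat.lt_succ_iff_lt_or_eq.1 hi with hi | rfl
        · exact h1 i hi
        · simpa [cons] using h2 0
      · rw [show i + (k + 1) = (i + 1) + k by omega, h2]
        rfl
      · rw [← h3, hS]
  obtain ⟨N, hN⟩ := IsLocallyConstant.exists_agree hc X
  refine (S N).2 fun A _ => ⟨id, strictMono_id, c X, fun Y _ => ?_⟩
  obtain ⟨Z, h1, -, h3⟩ := key N (A ∘ id ∘ Y)
  rw [h3, hN Z h1]

/-! ### Closure properties -/

/-- On a homogeneous subsequence `R` holds always or never; "never" contradicts `hR`, and "always"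
leaves only `R'` to be found. -/
theorem Bqo.inf {Q : Type v} {R R' : Q → Q → Prop} (hR : Bqo R) (hR' : Bqo R') :
    Bqo fun x y => R x y ∧ R' x y := by
  intro g hg
  have hc : IsLocallyConstant fun X => R (g X) (g (X ∘ Nat.succ)) :=
    (hg.prodMk (IsLocallyConstant.comp_shift hg)).comp fun q : Q × Q => R q.1 q.2
  obtain ⟨A, hA, p, hp⟩ := IsLocallyConstant.hasHomogeneous hc id strictMono_id
  have hgA := IsLocallyConstant.comp_left hg A
  by_cases h : p
  · obtain ⟨X, hX, hXR⟩ := hR' _ hgA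
    exact ⟨A ∘ X, hA.comp hX, (hp X hX).2 h, hXR⟩
  · obtain ⟨X, hX, hXR⟩ := hR _ hgA
    exact absurd ((hp X hX).1 hXR) h

theorem Bqo.mono {Q : Type v} {R R' : Q → Q → Prop} (hR : Bqo R) (h : ∀ x y, R x y → R' x y) :
    Bqo R' := fun g hg =>
  let ⟨X, hX, hXR⟩ := hR g hg
  ⟨X, hX, h _ _ hXR⟩

theorem Bqo.comap {Q : Type v} {Q' : Type w} {R : Q → Q → Prop} (hR : Bqo R) (φ : Q' → Q) :
    Bqo fun x y => R (φ x) (φ y) := fun _ hg => hR _ (hg.comp φ)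

/-- If witnesses of two consecutive failures of `R` are never related by the better quasi-order
`R'`, then `R` is a better quasi-order. -/
theorem Bqo.of_witness {Q : Type v} {Q' : Type w} {R : Q → Q → Prop} {R' : Q' → Q' → Prop}
    (hR' : Bqo R') (W : Q → Q → Q' → Prop) (hW : ∀ x y, ¬ R x y → ∃ q, W x y q)
    (h : ∀ x y z q q', W x y q → W y z q' → ¬ R' q q') : Bqo R := by
  intro g hg
  by_contra! hbad
  have : Nonempty Q' := ⟨(hW _ _ (hbad id strictMono_id)).choose⟩
  have hex : ∀ x y, ∃ q, ¬ R x y → W x y q := fun x y => by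
    by_cases hxy : R x y
    · exact ⟨Classical.arbitrary Q', fun h => absurd hxy h⟩
    · exact (hW x y hxy).imp fun q hq _ => hq
  choose q hq using hex
  -- Consecutive entries of the witness array share the middle value `g (X ∘ Nat.succ)`, as `h`
  -- requires.
  obtain ⟨X, hX, hXR⟩ := hR' (fun X => q (g X) (g (X ∘ Nat.succ)))
    ((hg.prodMk (IsLocallyConstant.comp_shift hg)).comp fun x : Q × Q => q x.1 x.2)
  have hX' : StrictMono (X ∘ Nat.succ) := hX.comp (fun _ _ => Nat.succ_lt_succ)
  exact h _ _ _ _ _ (hq _ _ (hbad X hX)) (hq _ _ (hbad _ hX')) hXR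

theorem bqo_nat_le : Bqo fun m n : ℕ => m ≤ n := by
  intro g _
  by_contra! hbad
  have hmono : ∀ i, StrictMono fun j : ℕ => j + i := fun i a b h => Nat.add_lt_add_right h i
  -- The successive tails of the identity sequence already give an infinite descent.
  have hanti : StrictAnti fun i => g fun j => j + i := by
    refine strictAnti_nat_of_succ_lt fun i => ?_
    have := hbad _ (hmono i)
    convert this using 3
    simp only [Function.comp_apply]
    omega
  exact WellFounded.not_rel_apply_succ (r := (· < ·)) (fun i => g fun j => j + i)
    |>.elim fun i hi => hi (hanti (Nat.lt_succ_self i))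

theorem Bqo.upperSet {P : Type v} [Preorder P] (hP : Bqo fun x y : P => x ≤ y) :
    Bqo fun U V : UpperSet P => (V : Set P) ⊆ U := by
  refine hP.of_witness (fun U V p => p ∈ V ∧ p ∉ U) (fun U V h => Set.not_subset.1 h) ?_
  rintro U V W p q ⟨hpV, -⟩ ⟨-, hqV⟩ hpq
  exact hqV (V.upper hpq hpV)

/-! ### Finite families of elements of a better quasi-order -/

/-- A finite family of elements of `P`. -/
structure Family (P : Type v) where
  idx : Type u
  [finite : Finite idx]
  val : idx → P

attribute [instance] Family.finite

/-- The number of members of a family that lie in `U`. -/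
noncomputable def Family.count {P : Type v} (A : Family.{u} P) (U : Set P) : ℕ :=
  {i | A.val i ∈ U}.ncard

/-- The members of `B` can be mapped onto those of `A` in a decreasing way. -/
def Family.SurjLE {P : Type v} [Preorder P] (A B : Family.{u} P) : Prop :=
  ∃ φ : B.idx → A.idx, Function.Surjective φ ∧ ∀ j, A.val (φ j) ≤ B.val j

theorem Family.exists_injective_le {P : Type v} [Preorder P] {A B : Family.{u} P}
    (h : ∀ U : UpperSet P, A.count U ≤ B.count U) :
    ∃ ψ : A.idx → B.idx, Function.Injective ψ ∧ ∀ i, A.val i ≤ B.val (ψ i) := by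
  classical
  have := Fintype.ofFinite B.idx
  refine (Fintype.all_card_le_filter_rel_iff_exists_injective
    fun i j => A.val i ≤ B.val j).1 fun S => ?_
  -- Hall's condition: the neighbours of `S` are the members of `B` in the upper set generated by
  -- `S`.
  let U : UpperSet P :=
    ⟨{p | ∃ i ∈ S, A.val i ≤ p}, fun p q hpq ⟨i, hi, hip⟩ => ⟨i, hi, hip.trans hpq⟩⟩
  calc S.card = (S : Set A.idx).ncard := (Set.ncard_coe_finset S).symm
    _ ≤ A.count U := Set.ncard_le_ncard (fun i hi => ⟨i, hi, le_rfl⟩) (Set.toFinite _)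
    _ ≤ B.count U := h U
    _ = _ := by
      rw [Family.count, ← Set.ncard_coe_finset]
      congr 1
      ext j
      simp only [Finset.coe_filter, Finset.mem_univ, true_and, Set.mem_ofPred_eq]
      exact Iff.rfl

theorem Family.surjLE_of {P : Type v} [Preorder P] {A B : Family.{u} P}
    (h : ∀ U : UpperSet P, A.count U ≤ B.count U) (h' : ∀ j, ∃ i, A.val i ≤ B.val j) :
    A.SurjLE B := by
  classical
  obtain ⟨ψ, hψ, hle⟩ := Family.exists_injective_le h
  choose θ hθ using h'
  -- Invert `ψ` on its range, which gives surjectivity, and use `θ` elsewhere.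
  refine ⟨fun j => if hj : ∃ i, ψ i = j then hj.choose else θ j, fun i => ⟨ψ i, ?_⟩, fun j => ?_⟩
  · have hi : ∃ k, ψ k = ψ i := ⟨i, rfl⟩
    simpa only [dif_pos hi] using hψ hi.choose_spec
  · by_cases hj : ∃ i, ψ i = j
    · simp only [dif_pos hj]
      exact (hle _).trans_eq (congrArg _ hj.choose_spec)
    · simpa only [dif_neg hj] using hθ j

theorem Bqo.family_smyth {P : Type v} [Preorder P] (hP : Bqo fun x y : P => x ≤ y) :
    Bqo fun A B : Family.{u} P => ∀ j, ∃ i, A.val i ≤ B.val j := by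
  refine hP.of_witness (fun A B p => p ∈ Set.range B.val ∧ ∀ i, ¬ A.val i ≤ p)
    (fun A B h => ?_) ?_
  · push Not at h
    obtain ⟨j, hj⟩ := h
    exact ⟨B.val j, ⟨j, rfl⟩, hj⟩
  · rintro A B C p q ⟨⟨j, rfl⟩, -⟩ ⟨-, h⟩
    exact h j

/-- A failure is witnessed by `(U, A.count U)`. If the next witness `(V, B.count V)` were above it,
then `A.count U ≤ B.count V ≤ B.count U`, contrary to the failure at `U`. -/
theorem Bqo.family_count {P : Type v} [Preorder P] (hP : Bqo fun x y : P => x ≤ y) :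
    Bqo fun A B : Family.{u} P => ∀ U : UpperSet P, A.count U ≤ B.count U := by
  have hprod := (hP.upperSet.comap (Prod.fst : UpperSet P × ℕ → _)).inf
    (bqo_nat_le.comap (Prod.snd : UpperSet P × ℕ → _))
  refine hprod.of_witness (fun A B q => q.2 = A.count q.1 ∧ B.count q.1 < q.2)
    (fun A B h => ?_) ?_
  · push Not at h
    obtain ⟨U, hU⟩ := h
    exact ⟨(U, A.count U), rfl, hU⟩
  · rintro A B C ⟨U, m⟩ ⟨V, k⟩ ⟨-, hm⟩ ⟨hk, -⟩ ⟨hVU, hmk⟩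
    have : B.count V ≤ B.count U := Set.ncard_le_ncard (fun i hi => hVU hi) (Set.toFinite _)
    dsimp only at hm hk hmk
    omega

theorem Bqo.family_surjLE {P : Type v} [Preorder P] (hP : Bqo fun x y : P => x ≤ y) :
    Bqo fun A B : Family.{u} P => A.SurjLE B :=
  (hP.family_count.inf hP.family_smyth).mono fun _ _ h => Family.surjLE_of h.1 h.2

/-! ### Co-trees without long combs -/

/-- The principal downset of `x` as a co-tree. -/
def FinCoTree.below (X : FinCoTree.{u}) (x : X.carrier) : FinCoTree.{u} where
  carrier := Set.Iic x
  isCoTree :=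
    { exists_coroot := ⟨⟨x, le_rfl⟩, fun y => y.2⟩
      isChain_Ici := fun y _ ha _ hb hab =>
        X.isCoTree.isChain_Ici y.1 ha hb fun h => hab (Subtype.ext h) }

theorem FinCoTree.comparable {X : FinCoTree.{u}} {a b c : X.carrier} (hb : a ≤ b) (hc : a ≤ c) :
    b ≤ c ∨ c ≤ b :=
  (X.isCoTree.isChain_Ici a).total hb hc

/-- A comb below `x`, a point `y` incomparable to `x` and a point `r` above both give a longer
comb. -/
theorem FinCoTree.exists_comb_succ {X : FinCoTree.{u}} {n : ℕ} {x y r : X.carrier}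
    (e : Comb n ↪o (X.below x).carrier) (hxy : ¬ x ≤ y) (hyx : ¬ y ≤ x) (hxr : x ≤ r)
    (hyr : y ≤ r) : Nonempty (Comb (n + 1) ↪o X.carrier) := by
  have hex : ∀ c, (e c).1 ≤ x := fun c => (e c).2
  have hre : ∀ c, ¬ r ≤ (e c).1 := fun c h => hyx (hyr.trans (h.trans (hex c)))
  have hye : ∀ c, ¬ y ≤ (e c).1 := fun c h => hyx (h.trans (hex c))
  have hey : ∀ c, ¬ (e c).1 ≤ y := fun c h =>
    (FinCoTree.comparable (hex c) h).elim hxy hyx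
  have hry : ¬ r ≤ y := fun h => hxy (hxr.trans h)
  have hee : ∀ c d, (e c).1 ≤ (e d).1 ↔ c ≤ d := fun c d => e.le_iff_le
  let f : Comb (n + 1) → X.carrier := fun
    | .spine i => Fin.lastCases r (fun j => (e (.spine j)).1) i
    | .tooth i => Fin.lastCases y (fun j => (e (.tooth j)).1) i
  have hf : ∀ c d, f c ≤ f d ↔ c ≤ d := by
    have hss : ∀ {m} (i j : Fin m), Comb.spine i ≤ Comb.spine j ↔ i ≤ j := fun _ _ => Iff.rfl
    have hts : ∀ {m} (i j : Fin m), Comb.tooth i ≤ Comb.spine j ↔ i ≤ j := fun _ _ => Iff.rfl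
    have hst : ∀ {m} (i j : Fin m), Comb.spine i ≤ Comb.tooth j ↔ False := fun _ _ => Iff.rfl
    have htt : ∀ {m} (i j : Fin m), Comb.tooth i ≤ Comb.tooth j ↔ i = j := fun _ _ => Iff.rfl
    rintro (i | i) (j | j) <;> refine Fin.lastCases ?_ (fun i => ?_) i <;>
      refine Fin.lastCases ?_ (fun j => ?_) j <;>
      simp [f, hss, hts, hst, htt, hre, hye, hey, hry, hee, hyr, (hex _).trans hxr,
        Fin.le_last, Fin.castSucc_ne_last, (Fin.castSucc_ne_last _).symm]
  exact ⟨OrderEmbedding.ofMapLEIff f hf⟩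

/-- Take `x` minimal with the `n`-comb embedding below it, or the greatest element if there is none.
A point incomparable to such a minimal `x` would be a new tooth, with the greatest element as new
end of the spine. -/
theorem FinCoTree.exists_stem {n : ℕ} {X : FinCoTree.{u}}
    (hX : IsEmpty (Comb (n + 1) ↪o X.carrier)) :
    ∃ x : X.carrier, (∀ y, y ≤ x ∨ x ≤ y) ∧
      ∀ z < x, IsEmpty (Comb n ↪o (X.below z).carrier) := by
  obtain ⟨r, hr⟩ := X.isCoTree.exists_coroot
  by_cases h : ∃ x : X.carrier, Nonempty (Comb n ↪o (X.below x).carrier)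
  · obtain ⟨x, ⟨e⟩, hmin⟩ := (Set.toFinite {x | Nonempty (Comb n ↪o (X.below x).carrier)}).exists_minimal h
    refine ⟨x, fun y => ?_, fun z hz => not_nonempty_iff.1 fun hne => hz.not_ge (hmin hne hz.le)⟩
    by_contra! hy
    exact (FinCoTree.exists_comb_succ e hy.2 hy.1 (hr x) (hr y)).elim hX.elim
  · exact ⟨r, fun y => Or.inl (hr y), fun z _ => not_nonempty_iff.1 fun hne => h ⟨z, hne⟩⟩

theorem exists_monotone_surjective {α β : Type*} [LinearOrder α] [LinearOrder β] [Finite α]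
    [Finite β] [Nonempty β] (h : Nat.card β ≤ Nat.card α) :
    ∃ f : α → β, Monotone f ∧ Function.Surjective f := by
  have := Fintype.ofFinite α
  have := Fintype.ofFinite β
  let a := Fintype.orderIsoFinOfCardEq α (Nat.card_eq_fintype_card (α := α)).symm
  let b := Fintype.orderIsoFinOfCardEq β (Nat.card_eq_fintype_card (α := β)).symm
  have hpos : 0 < Nat.card β := Nat.card_pos
  -- Surplus top elements of `α` all go to the top of `β`.
  refine ⟨fun x => b ⟨min (a.symm x) (Nat.card β - 1), by omega⟩, fun x y hxy => ?_, fun y => ?_⟩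
  · refine b.monotone (Fin.mk_le_mk.2 (min_le_min_right _ ?_))
    exact a.symm.monotone hxy
  · have hlt := (b.symm y).2
    refine ⟨a ⟨b.symm y, hlt.trans_le h⟩, ?_⟩
    rw [← b.eq_symm_apply]
    apply Fin.ext
    simp only [OrderIso.symm_apply_apply]
    omega

theorem FinCoTree.exists_monotone_surjective_Ici {X Y : FinCoTree.{u}} (x : X.carrier)
    (y : Y.carrier) (h : (Set.Ici x).ncard ≤ (Set.Ici y).ncard) :
    ∃ f : Set.Ici y → Set.Ici x, Monotone f ∧ Function.Surjective f := by
  classical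
  let lin : ∀ (Z : FinCoTree.{u}) (z : Z.carrier), LinearOrder (Set.Ici z) := fun Z z =>
    { (inferInstance : PartialOrder (Set.Ici z)) with
      le_total := fun a b => FinCoTree.comparable a.2 b.2
      toDecidableLE := Classical.decRel _ }
  let _ := lin X x
  let _ := lin Y y
  exact exists_monotone_surjective h

/-- The coatoms of the principal downset of `x`, as a family of co-trees. -/
def FinCoTree.branches (X : FinCoTree.{u}) (x : X.carrier) (n : ℕ)
    (h : ∀ z < x, IsEmpty (Comb n ↪o (X.below z).carrier)) : Family.{u} (T.{u} n) where
  idx := {z : X.carrier // z ⋖ x}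
  val z := ⟨Quotient.mk _ (X.below z.1), _, rfl, h z.1 z.2.lt⟩

theorem FinCoTree.leP_of_branches {X Y : FinCoTree.{u}} {x : X.carrier} {y : Y.carrier}
    (hx : ∀ z, z ≤ x ∨ x ≤ z) (hy : ∀ z, z ≤ y ∨ y ≤ z)
    (hcard : (Set.Ici x).ncard ≤ (Set.Ici y).ncard)
    (φ : {w : Y.carrier // w ⋖ y} → {z : X.carrier // z ⋖ x}) (hφ : Function.Surjective φ)
    (hle : ∀ w, (X.below (φ w).1).LeP (Y.below w.1)) : X.LeP Y := by
  classical
  obtain ⟨g, hg, hgs⟩ := FinCoTree.exists_monotone_surjective_Ici x y hcard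
  choose f hf hfs using hle
  have hlt : ∀ v : Y.carrier, ¬ y ≤ v → ∃ w : {w : Y.carrier // w ⋖ y}, v ≤ w.1 := fun v hv =>
    let ⟨w, hvw, hwy⟩ := exists_le_covBy_of_lt (((hy v).resolve_right hv).lt_of_not_ge hv)
    ⟨⟨w, hwy⟩, hvw⟩
  choose c hc using hlt
  have hcuniq : ∀ v hv (w : {w : Y.carrier // w ⋖ y}), v ≤ w.1 → c v hv = w := by
    intro v hv w hvw
    rcases FinCoTree.comparable (hc v hv) hvw with h | h
    · exact Subtype.ext (((c v hv).2.eq_or_eq h w.2.le).resolve_right w.2.ne).symm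
    · exact Subtype.ext ((w.2.eq_or_eq h (c v hv).2.le).resolve_right (c v hv).2.ne)
  -- The chain above `y` is sent by `g`; any other point lies under exactly one coatom `w` of `↓y`
  -- and is sent by `f w`.
  let F : Y.carrier → X.carrier := fun v =>
    if hv : y ≤ v then (g ⟨v, hv⟩).1 else (f (c v hv) ⟨v, hc v hv⟩).1
  have hFup : ∀ v (hv : y ≤ v), F v = (g ⟨v, hv⟩).1 := fun v hv => dif_pos hv
  have hFdown : ∀ (w : {w : Y.carrier // w ⋖ y}) v (hv : v ≤ w.1), F v = (f w ⟨v, hv⟩).1 := by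
    intro w v hv
    have hyv : ¬ y ≤ v := fun h => w.2.lt.not_ge (h.trans hv)
    obtain rfl := hcuniq v hyv w hv
    exact dif_neg hyv
  have hFlt : ∀ (w : {w : Y.carrier // w ⋖ y}) v, v ≤ w.1 → F v ≤ (φ w).1 := by
    intro w v hv
    rw [hFdown w v hv]
    exact (f w ⟨v, hv⟩).2
  have hFx : ∀ v, y ≤ v → x ≤ F v := by
    intro v hv
    rw [hFup v hv]
    exact (g ⟨v, hv⟩).2
  have hsurjUp : ∀ x', x ≤ x' → ∃ v, y ≤ v ∧ F v = x' := by
    intro x' hx'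
    obtain ⟨v, hv⟩ := hgs ⟨x', hx'⟩
    exact ⟨v.1, v.2, by rw [hFup v.1 v.2, hv]⟩
  have hsurjDown : ∀ x', ¬ x ≤ x' → ∃ v, v ≤ y ∧ F v = x' := by
    intro x' hx'
    obtain ⟨z, hz, hzx⟩ := exists_le_covBy_of_lt (((hx x').resolve_right hx').lt_of_not_ge hx')
    obtain ⟨w, hw⟩ := hφ ⟨z, hzx⟩
    obtain ⟨v, hv⟩ := hfs w ⟨x', by rw [Set.mem_Iic, hw]; exact hz⟩
    exact ⟨v.1, (show v.1 ≤ w.1 from v.2).trans w.2.le, by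
      rw [hFdown w v.1 v.2]; exact congrArg Subtype.val hv⟩
  have hmono : ∀ v v', v ≤ v' → F v ≤ F v' := by
    intro v v' hvv'
    by_cases hv' : y ≤ v'
    · by_cases hv : y ≤ v
      · rw [hFup v hv, hFup v' hv']
        exact hg hvv'
      · exact (hFlt _ v (hc v hv)).trans ((φ _).2.le.trans (hFx v' hv'))
    · have h' := hc v' hv'
      rw [hFdown _ v (hvv'.trans h'), hFdown _ v' h']
      exact (hf _).mono _ _ hvv'
  refine ⟨F, ⟨hmono, fun v x' h => ?_, fun v x' h => ?_⟩, fun x' => ?_⟩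
  · by_cases hx' : x ≤ x'
    · obtain ⟨u, hu, rfl⟩ := hsurjUp x' hx'
      rcases hy v with hv | hv
      · exact ⟨u, hv.trans hu, rfl⟩
      · rcases FinCoTree.comparable hv hu with hvu | huv
        · exact ⟨u, hvu, rfl⟩
        · exact ⟨v, le_rfl, le_antisymm h (hmono _ _ huv)⟩
    · have hv : ¬ y ≤ v := fun hv => hx' ((hFx v hv).trans h)
      have hw := hc v hv
      generalize c v hv = w at hw
      -- Both points lie above `F v`, hence are comparable, and nothing lies strictly between `φ w`
      -- and `x`.
      have hx'w : x' ≤ (φ w).1 := by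
        rcases FinCoTree.comparable h (hFlt w v hw) with h1 | h1
        · exact h1
        · rcases (φ w).2.eq_or_eq h1 ((hx x').resolve_right hx') with h2 | h2
          · exact h2.le
          · exact absurd h2.ge hx'
      rw [hFdown w v hw] at h
      obtain ⟨u, hu, hux⟩ := (hf w).up ⟨v, hw⟩ ⟨x', hx'w⟩ h
      exact ⟨u.1, hu, by rw [hFdown w u.1 u.2]; exact congrArg Subtype.val hux⟩
  · by_cases hv : y ≤ v
    · by_cases hx' : x ≤ x'
      · obtain ⟨u, hu, rfl⟩ := hsurjUp x' hx'
        rcases FinCoTree.comparable hv hu with hvu | huv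
        · exact ⟨v, le_rfl, le_antisymm (hmono _ _ hvu) h⟩
        · exact ⟨u, huv, rfl⟩
      · obtain ⟨u, hu, rfl⟩ := hsurjDown x' hx'
        exact ⟨u, hu.trans hv, rfl⟩
    · have hw := hc v hv
      generalize c v hv = w at hw
      have hx'w := h.trans (hFlt w v hw)
      rw [hFdown w v hw] at h
      obtain ⟨u, hu, hux⟩ := (hf w).down ⟨v, hw⟩ ⟨x', hx'w⟩ h
      exact ⟨u.1, hu, by rw [hFdown w u.1 u.2]; exact congrArg Subtype.val hux⟩
  · by_cases hx' : x ≤ x'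
    · exact (hsurjUp x' hx').imp fun _ h => h.2
    · exact (hsurjDown x' hx').imp fun _ h => h.2

theorem bqo_T_succ {n : ℕ} (hn : Bqo fun p q : T.{u} n => p ≤ q) :
    Bqo fun p q : T.{u} (n + 1) => p ≤ q := by
  have hstem : ∀ q : T.{u} (n + 1), ∃ (X : FinCoTree.{u}) (x : X.carrier),
      (Quotient.mk _ X : CoTreeClass.{u}) = q.1 ∧ (∀ y, y ≤ x ∨ x ≤ y) ∧
        ∀ z < x, IsEmpty (Comb n ↪o (X.below z).carrier) := by
    rintro ⟨q, X, hXq, hX⟩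
    obtain ⟨x, hx⟩ := FinCoTree.exists_stem hX
    exact ⟨X, x, hXq, hx⟩
  choose X x hX hx hcomb using hstem
  refine ((bqo_nat_le.comap fun q => (Set.Ici (x q)).ncard).inf
    (hn.family_surjLE.comap fun q => (X q).branches (x q) n (hcomb q))).mono ?_
  rintro p q ⟨hcard, φ, hφ, hle⟩
  have : (X p).LeP (X q) := FinCoTree.leP_of_branches (hx p) (hx q) hcard φ hφ hle
  change p.1 ≤ q.1
  rw [← hX p, ← hX q]
  exact this

theorem bqo_T (n : ℕ) : Bqo fun p q : T.{u} n => p ≤ q := by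
  induction n with
  | zero =>
    intro g _
    obtain ⟨X, -, hX⟩ := (g id).2
    refine (hX.elim (OrderEmbedding.ofMapLEIff ?_ ?_))
    · rintro (i | i) <;> exact i.elim0
    · rintro (i | i) <;> exact i.elim0
  | succ n ih => exact bqo_T_succ ih

/-! ### From fronts to locally constant arrays -/

/-- The increasing sequence obtained from `X` by raising terms when necessary. -/
def straighten (X : ℕ → ℕ) : ℕ → ℕ
  | 0 => X 0
  | i + 1 => max (X (i + 1)) (straighten X i + 1)

theorem strictMono_straighten (X : ℕ → ℕ) : StrictMono (straighten X) :=
  strictMono_nat_of_lt_succ fun _ => (Nat.lt_succ_self _).trans_le (le_max_right _ _)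

theorem straighten_eq {X : ℕ → ℕ} (hX : StrictMono X) : straighten X = X := by
  funext i
  induction i with
  | zero => rfl
  | succ i ih => rw [straighten, ih, max_eq_left (hX (Nat.lt_succ_self i))]

theorem straighten_congr {X Y : ℕ → ℕ} {i : ℕ} (h : ∀ j ≤ i, X j = Y j) :
    straighten X i = straighten Y i := by
  induction i with
  | zero => exact h 0 le_rfl
  | succ i ih => rw [straighten, straighten, h _ le_rfl, ih fun j hj => h j (hj.trans i.le_succ)]

theorem Extends.of_agree {s : Finset ℕ} {A B : ℕ → ℕ} {N : ℕ} (hB : StrictMono B)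
    (hs : Extends (s : Set ℕ) (Set.range A)) (hN : ∀ b ∈ s, b < A N)
    (h : ∀ i ≤ N, B i = A i) (hA : StrictMono A) : Extends (s : Set ℕ) (Set.range B) := by
  refine ⟨fun b hb => ?_, ?_⟩
  · obtain ⟨i, rfl⟩ := hs.1 hb
    exact ⟨i, h i (hA.lt_iff_lt.1 (hN _ hb)).le⟩
  · rintro b hb _ ⟨j, rfl⟩ hle
    have hj : j < N := by
      rw [← hB.lt_iff_lt, h N le_rfl]
      exact hle.trans_lt (hN b hb)
    exact hs.2 b hb _ ⟨j, (h j hj.le).symm⟩ hle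

theorem sInf_range_of_strictMono {X : ℕ → ℕ} (hX : StrictMono X) : sInf (Set.range X) = X 0 := by
  refine le_antisymm (Nat.sInf_le ⟨0, rfl⟩) ?_
  obtain ⟨i, hi⟩ := Nat.sInf_mem (Set.range_nonempty X)
  rw [← hi]
  exact hX.monotone (Nat.zero_le i)

theorem range_shift_of_strictMono {X : ℕ → ℕ} (hX : StrictMono X) :
    Set.range (X ∘ Nat.succ) = Set.range X \ {sInf (Set.range X)} := by
  rw [sInf_range_of_strictMono hX]
  ext m
  constructor
  · rintro ⟨i, rfl⟩
    exact ⟨⟨i + 1, rfl⟩, (hX (Nat.succ_pos i)).ne'⟩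
  · rintro ⟨⟨i | i, rfl⟩, h⟩
    · exact absurd rfl h
    · exact ⟨i, rfl⟩

/-- A front assigns to each infinite subset of `A` its unique initial segment in `F`, and dropping
the first term of a sequence realizes the shift. `straighten` extends this assignment to arbitrary
sequences. -/
theorem Bqo.isBPO {P : Type v} [PartialOrder P] (hP : Bqo fun x y : P => x ≤ y) : IsBPO P := by
  rintro F ⟨A, hA, hF⟩ f hbad
  obtain ⟨e, he, hrange⟩ : ∃ e : ℕ → ℕ, StrictMono e ∧ Set.range e = A := by
    classical
    have := hA.to_subtype
    exact ⟨Nat.orderEmbeddingOfSet A, (Nat.orderEmbeddingOfSet A).strictMono,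
      Nat.orderEmbeddingOfSet_range A⟩
  have hmono : ∀ X, StrictMono (e ∘ straighten X) := fun X => he.comp (strictMono_straighten X)
  have hsub : ∀ X : ℕ → ℕ, Set.range (e ∘ straighten X) ⊆ A := fun X =>
    hrange ▸ Set.range_comp_subset_range _ _
  have hinf : ∀ X, (Set.range (e ∘ straighten X)).Infinite := fun X =>
    Set.infinite_range_of_injective (hmono X).injective
  choose s hs huniq using fun X => hF.existsUnique _ (hsub X) (hinf X)
  let t : (ℕ → ℕ) → F := fun X => ⟨s X, (hs X).1⟩
  have ht : IsLocallyConstant t := by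
    refine isLocallyConstant_of_agree fun X => ?_
    -- Past this bound the sequence no longer affects which member of `F` is initial.
    obtain ⟨N, hN⟩ : ∃ N, ∀ b ∈ s X, b < (e ∘ straighten X) N :=
      ⟨(s X).sup id + 1, fun b hb => (Nat.lt_succ_of_le (Finset.le_sup (f := id) hb)).trans_le
        (hmono X).le_apply⟩
    refine ⟨N + 1, fun Y hY => Subtype.ext (huniq Y _ ⟨(hs X).1, ?_⟩).symm⟩
    refine Extends.of_agree (hmono Y) (hs X).2 hN (fun i hi => ?_) (hmono X)
    exact congrArg e (straighten_congr fun j hj => hY j (by omega))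
  obtain ⟨X, hX, hle⟩ := hP (f ∘ t) (ht.comp f)
  refine hbad _ _ ⟨Set.range (e ∘ straighten X), hinf X, (hs X).2, ?_⟩ hle
  have h := (hs (X ∘ Nat.succ)).2
  have hX' : StrictMono (X ∘ Nat.succ) := hX.comp (fun _ _ => Nat.succ_lt_succ)
  rw [straighten_eq hX', ← Function.comp_assoc, range_shift_of_strictMono (he.comp hX)] at h
  rwa [straighten_eq hX]

theorem Bqo.finite_of_isAntichain {P : Type v} [PartialOrder P] (hP : Bqo fun x y : P => x ≤ y)
    {S : Set P} (hS : IsAntichain (· ≤ ·) S) : S.Finite := by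
  by_contra hinf
  let a := Set.Infinite.natEmbedding S hinf
  -- Reading only the first term turns the array into an ordinary sequence.
  obtain ⟨X, hX, hle⟩ := hP (fun X => (a (X 0) : P))
    (isLocallyConstant_of_agree fun X => ⟨1, fun Y hY => by rw [hY 0 Nat.one_pos]⟩)
  have heq := a.injective (Subtype.ext (hS.eq (a _).2 (a _).2 hle))
  exact (hX Nat.one_pos).ne heq

end CoTrees

theorem proposition4p10 (n : ℕ) (hn : 0 < n) :
    CoTrees.IsBPO (CoTrees.T.{u} n) ∧
      ∀ S : Set (CoTrees.T.{u} n), IsAntichain (· ≤ ·) S → S.Finite :=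
  ⟨(CoTrees.bqo_T n).isBPO, fun _ hS => (CoTrees.bqo_T n).finite_of_isAntichain hS⟩
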